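/- Let $M$ be an uncountable separable metrizable space. A family $\mathcal C$ of subsets of $M$ generates the topology of $M$ if, for every $A\subseteq M$, $A$ is closed in $M$ if and only if $A\cap C$ is closed in $C$ for every $C\in\mathcal C$. Let $\mathrm{seq}(M)$ be the minimum size of a family of infinite convergent sequences in $M$ (each taken as a set together with its limit) that generates the topology of $M$. For a cardinal $\kappa$, let $\mathrm{cov}(\kappa)$ be the minimum size of a family of countable subsets of $\kappa$ such that every countable subset of $\kappa$ is contained in a member of the family. Let $\mathfrak b$ be the minimum size of a subset of $\omega^\omega$ that is unbounded with respect to the mod finite order $<^*$, where $f<^*g$ if $f(n)<g(n)$ for all but finitely many $n$. Call $M$ locally small if every point of $M$ has a neighborhood of size strictly less than $|M|$. (i) If $M$ is not locally small, then $\mathrm{seq}(M)=\mathrm{cov}(|M|)\cdot\mathfrak b$. (ii) If $M$ is locally small, then $\mathrm{seq}(M)=\lim_{\mu<|M|}\mathrm{cov}(\mu)\cdot\mathfrak b$, where $\mu$ ranges over the cardinals less than $|M|$ and the limit of this nondecreasing function is its supremum. -/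

import Mathlib

open Cardinal Filter Topology

universe u

/-- `C` is an infinite convergent sequence of `M` together with its limit. -/
def IsConvergentSequence {M : Type u} [TopologicalSpace M] (C : Set M) : Prop :=
  C.Infinite ∧ ∃ (s : ℕ → M) (x : M), Tendsto s atTop (𝓝 x) ∧ C = insert x (Set.range s)

/-- The family `𝒞` of subsets of `M` generates the topology of `M`: a set `A` is closed in `M`
if and only if `A ∩ C` is closed in the subspace `C` for every `C ∈ 𝒞`. -/
def GeneratesTopology {M : Type u} [TopologicalSpace M] (𝒞 : Set (Set M)) : Prop :=
  ∀ A : Set M, IsClosed A ↔ ∀ C ∈ 𝒞, IsClosed ((Subtype.val : C → M) ⁻¹' A)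

/-- The sequentiality number of `M`: the minimum size of a family of convergent sequences of `M`
which generates the topology of `M`. -/
noncomputable def seqNumber (M : Type u) [TopologicalSpace M] : Cardinal.{u} :=
  sInf {c | ∃ 𝒞 : Set (Set M),
    (∀ C ∈ 𝒞, IsConvergentSequence C) ∧ GeneratesTopology 𝒞 ∧ #𝒞 = c}

/-- The covering number of `κ`: the minimum size of a family of countable subsets of (a set of
size) `κ` such that every countable subset is contained in an element of the family. -/
noncomputable def covNumber (κ : Cardinal.{u}) : Cardinal.{u} :=
  sInf {c | ∃ F : Set (Set κ.out),
    (∀ S ∈ F, S.Countable) ∧ (∀ T : Set κ.out, T.Countable → ∃ S ∈ F, T ⊆ S) ∧ #F = c}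

/-- The bounding number: the minimum size of a subset of `ℕ → ℕ` which is unbounded with respect
to the strict mod finite order. -/
noncomputable def boundingNumber : Cardinal.{0} :=
  sInf {c | ∃ S : Set (ℕ → ℕ),
    (¬ ∃ g : ℕ → ℕ, ∀ f ∈ S, ∀ᶠ n in atTop, f n < g n) ∧ #S = c}

/-- Every point of `M` has a neighborhood of size strictly less than the size of `M`. -/
def IsLocallySmall (M : Type u) [TopologicalSpace M] : Prop :=
  ∀ x : M, ∃ U ∈ 𝓝 x, #U < #M

/-- The limit over `μ < κ` of `cov(μ) · 𝔟`. As `cov` is nondecreasing, this is the supremum; the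
family is bounded above, being indexed by a small set. -/
noncomputable def covBoundingLimit (κ : Cardinal.{u}) : Cardinal.{u} :=
  ⨆ μ : Set.Iio κ, covNumber μ.1 * lift.{u} boundingNumber

theorem bddAbove_covBoundingLimit (κ : Cardinal.{u}) :
    BddAbove (Set.range fun μ : Set.Iio κ => covNumber μ.1 * lift.{u} boundingNumber) :=
  bddAbove_of_small

/-! A family of convergent sequences generates the topology once, whenever `x` lies in the closure
of `A` but not in `A`, some member converging to `x` meets `A` infinitely often. The count is
therefore made at a single point. Upper bound (`exists_local_family`): cover the countable subsets
of a neighborhood `U` of `x` by `cov(|U|)` countable sets, and thin each one to sets converging to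
`x`, using an unbounded family of `𝔟` functions. Taking the union over all `x` is free, since `|M|`
is absorbed. Lower bound: near a point whose neighborhoods are all large, sequences tending to `x`
can code countable sets (`covNumber_le`) or functions (`boundingNumber_le`), and a member containing
infinitely many terms decodes them. Without local smallness one point has all neighborhoods of size
`|M|`; otherwise Lindelöf gives a suitable point for each `μ < |M|`. -/

section ConvergentSets

variable {M : Type u} [TopologicalSpace M]

/-- Every neighborhood of `x` contains all but finitely many points of `C`. -/
def ConvergesTo (C : Set M) (x : M) : Prop :=
  ∀ V ∈ 𝓝 x, (C \ V).Finite

theorem convergesTo_range {s : ℕ → M} {x : M} (hs : Tendsto s atTop (𝓝 x)) :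
    ConvergesTo (Set.range s) x := by
  intro V hV
  have h : {n | s n ∉ V}.Finite := by
    have := hs.eventually_mem hV
    rwa [← Nat.cofinite_eq_atTop] at this
  refine (h.image s).subset ?_
  rintro _ ⟨⟨n, rfl⟩, hn⟩
  exact ⟨n, hn, rfl⟩

theorem IsConvergentSequence.exists_convergesTo {C : Set M} (hC : IsConvergentSequence C) :
    ∃ x, ConvergesTo C x := by
  obtain ⟨-, s, x, hs, rfl⟩ := hC
  refine ⟨x, fun V hV => (convergesTo_range hs V hV).subset ?_⟩
  rintro y ⟨rfl | hy, hyV⟩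
  · exact absurd (mem_of_mem_nhds hV) hyV
  · exact ⟨hy, hyV⟩

theorem IsConvergentSequence.countable {C : Set M} (hC : IsConvergentSequence C) :
    C.Countable := by
  obtain ⟨-, s, x, -, rfl⟩ := hC
  exact (Set.countable_range s).insert x

theorem isConvergentSequence_insert {C : Set M} {x : M} (hC : C.Infinite) (hcount : C.Countable)
    (hconv : ConvergesTo C x) : IsConvergentSequence (insert x C) := by
  refine ⟨hC.mono (Set.subset_insert _ _), ?_⟩
  have := hC.to_subtype
  have := hcount.to_subtype
  obtain ⟨e⟩ := nonempty_equiv_of_countable (α := ℕ) (β := C)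
  refine ⟨fun n => e n, x, fun V hV => ?_, ?_⟩
  · rw [Filter.mem_map, ← Nat.cofinite_eq_atTop, Filter.mem_cofinite]
    refine ((hconv V hV).preimage
      (f := fun n => (e n : M)) (Subtype.val_injective.comp e.injective).injOn).subset ?_
    exact fun n hn => ⟨(e n).2, hn⟩
  · congr 1
    ext y
    exact ⟨fun hy => ⟨e.symm ⟨y, hy⟩, by simp⟩, by rintro ⟨n, rfl⟩; exact (e n).2⟩

theorem ConvergesTo.finite_inter [T2Space M] {A C : Set M} {x z : M} (hA : ConvergesTo A x)
    (hC : ConvergesTo C z) (hne : x ≠ z) : (A ∩ C).Finite := by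
  obtain ⟨V, W, hV, hW, hd⟩ := t2_separation_nhds hne
  refine ((hA V hV).union (hC W hW)).subset fun y hy => ?_
  by_cases hyV : y ∈ V
  · exact Or.inr ⟨hy.2, fun hyW => Set.disjoint_left.1 hd hyV hyW⟩
  · exact Or.inl ⟨hy.1, hyV⟩

/-- A generating family meets every nontrivial convergent sequence in infinitely many terms,
with the same limit. -/
theorem GeneratesTopology.exists_infinite_inter [T2Space M] {𝒞 : Set (Set M)}
    (hgen : GeneratesTopology 𝒞) (hseq : ∀ C ∈ 𝒞, IsConvergentSequence C) {a : ℕ → M} {x : M}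
    (ha : Tendsto a atTop (𝓝 x)) (hne : ∀ n, a n ≠ x) :
    ∃ C ∈ 𝒞, ConvergesTo C x ∧ {n | a n ∈ C}.Infinite := by
  have hncl : ¬ IsClosed (Set.range a) := fun h => by
    obtain ⟨n, hn⟩ := h.mem_of_tendsto ha (Eventually.of_forall fun n => Set.mem_range_self n)
    exact hne n hn
  rw [hgen] at hncl
  push Not at hncl
  obtain ⟨C, hC, hcl⟩ := hncl
  have hinf : (Set.range a ∩ C).Infinite := fun hfin => hcl <| by
    have : (Subtype.val : C → M) ⁻¹' Set.range a = Subtype.val ⁻¹' (Set.range a ∩ C) := by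
      ext y; simp
    rw [this]
    exact hfin.isClosed.preimage continuous_subtype_val
  obtain ⟨z, hz⟩ := (hseq C hC).exists_convergesTo
  have hxz : x = z := by
    by_contra h
    exact hinf ((convergesTo_range ha).finite_inter hz h)
  subst hxz
  refine ⟨C, hC, hz, fun hfin => hinf ((hfin.image a).subset ?_)⟩
  rintro _ ⟨⟨n, rfl⟩, hn⟩
  exact ⟨n, hn, rfl⟩

theorem generatesTopology_of_infinite_inter [T2Space M] {𝒞 : Set (Set M)}
    (h : ∀ A : Set M, ∀ x ∈ closure A, x ∉ A →
      ∃ C ∈ 𝒞, x ∈ C ∧ ConvergesTo C x ∧ (C ∩ A).Infinite) :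
    GeneratesTopology 𝒞 := by
  refine fun A => ⟨fun hA C _ => hA.preimage continuous_subtype_val, fun hA => ?_⟩
  refine isClosed_of_closure_subset fun x hx => ?_
  by_contra hxA
  obtain ⟨C, hC, hxC, hconv, hinf⟩ := h A x hx hxA
  have hmem : (⟨x, hxC⟩ : C) ∈ (Subtype.val : C → M) ⁻¹' A := by
    rw [← (hA C hC).closure_eq, closure_subtype, mem_closure_iff_nhds]
    intro V hV
    by_contra hemp
    refine hinf ((hconv V hV).subset fun y hy => ⟨hy.1, fun hyV => hemp ⟨y, hyV, ?_⟩⟩)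
    exact ⟨⟨y, hy.1⟩, hy.2, rfl⟩
  exact hxA hmem

end ConvergentSets

/-! ### Arithmetic of `cov` and `𝔟` -/

section Cardinals

theorem exists_unbounded_mk_eq_boundingNumber : ∃ S : Set (ℕ → ℕ),
    (¬ ∃ g : ℕ → ℕ, ∀ f ∈ S, ∀ᶠ n in atTop, f n < g n) ∧ #S = boundingNumber := by
  refine csInf_mem (s := {c | ∃ S : Set (ℕ → ℕ),
    (¬ ∃ g : ℕ → ℕ, ∀ f ∈ S, ∀ᶠ n in atTop, f n < g n) ∧ #S = c}) ⟨_, Set.univ, ?_, rfl⟩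
  rintro ⟨g, hg⟩
  obtain ⟨n, hn⟩ := (hg g trivial).exists
  exact lt_irrefl _ hn

theorem aleph0_le_boundingNumber : ℵ₀ ≤ boundingNumber := by
  obtain ⟨S, hS, hcard⟩ := exists_unbounded_mk_eq_boundingNumber
  by_contra! h
  rw [← hcard, Cardinal.lt_aleph0_iff_set_finite] at h
  refine hS ⟨fun n => ∑ f ∈ h.toFinset, f n + 1, fun f hf => Eventually.of_forall fun n => ?_⟩
  exact Nat.lt_succ_of_le
    (Finset.single_le_sum (f := fun f : ℕ → ℕ => f n) (fun _ _ => Nat.zero_le _)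
      (h.mem_toFinset.2 hf))

theorem aleph0_le_lift_boundingNumber : ℵ₀ ≤ lift.{u} boundingNumber :=
  aleph0_le_lift.2 aleph0_le_boundingNumber

theorem exists_cover_mk_eq_covNumber (X : Type u) : ∃ F : Set (Set X),
    (∀ S ∈ F, S.Countable) ∧ (∀ T : Set X, T.Countable → ∃ S ∈ F, T ⊆ S) ∧
      #F = covNumber #X := by
  obtain ⟨F, hF, hcov, hcard⟩ := csInf_mem (s := {c | ∃ F : Set (Set (#X).out),
    (∀ S ∈ F, S.Countable) ∧ (∀ T : Set (#X).out, T.Countable → ∃ S ∈ F, T ⊆ S) ∧ #F = c})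
    ⟨_, {S | S.Countable}, fun S hS => hS, fun T hT => ⟨T, hT, subset_rfl⟩, rfl⟩
  have e : (#X).out ≃ X := outMkEquiv
  refine ⟨Set.image e '' F, ?_, fun T hT => ?_, ?_⟩
  · rintro _ ⟨S, hS, rfl⟩
    exact (hF S hS).image e
  · obtain ⟨S, hS, hTS⟩ := hcov (e ⁻¹' T) (hT.preimage e.injective)
    refine ⟨_, ⟨S, hS, rfl⟩, fun y hy => ⟨e.symm y, hTS (by simpa using hy), by simp⟩⟩
  · rw [mk_image_eq e.injective.image_injective, hcard]
    rfl

theorem one_le_covNumber (κ : Cardinal.{u}) : 1 ≤ covNumber κ := by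
  obtain ⟨F, -, hcov, hcard⟩ := exists_cover_mk_eq_covNumber κ.out
  rw [mk_out] at hcard
  obtain ⟨S, hS, -⟩ := hcov ∅ Set.countable_empty
  rw [← hcard, Cardinal.one_le_iff_ne_zero, Cardinal.mk_ne_zero_iff]
  exact ⟨⟨S, hS⟩⟩

/-- A covering family exhausts `κ` by countable pieces. -/
theorem le_covNumber_mul_of_aleph0_le (κ : Cardinal.{u}) {b : Cardinal.{u}} (hb : ℵ₀ ≤ b) :
    κ ≤ covNumber κ * b := by
  obtain ⟨F, hF, hcov, hcard⟩ := exists_cover_mk_eq_covNumber κ.out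
  rw [mk_out] at hcard
  have hun : ⋃₀ F = Set.univ := Set.eq_univ_of_forall fun y => by
    obtain ⟨S, hS, hy⟩ := hcov {y} (Set.countable_singleton y)
    exact ⟨S, hS, hy rfl⟩
  calc κ = #(⋃₀ F) := by rw [hun, mk_univ, mk_out]
    _ ≤ #F * ⨆ S : F, #S := mk_sUnion_le F
    _ ≤ covNumber κ * b := by
      rw [hcard]
      gcongr
      exact ciSup_le' fun S => (hF S S.2).le_aleph0.trans hb

end Cardinals

/-! ### Generating families from covers and unbounded functions -/

section UpperBound

variable {M : Type u} [MetricSpace M]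

/-- The points of `S` whose code is bounded by a function of their proximity to `x`. -/
def boundedPart (x : M) (S : Set M) (e : M → ℕ) (f : ℕ → ℕ) : Set M :=
  {y ∈ S | y ≠ x ∧ e y ≤ ∑ i ∈ Finset.range (⌊(dist y x)⁻¹⌋₊ + 1), f i}

theorem convergesTo_boundedPart (x : M) {S : Set M} {e : M → ℕ} (he : S.InjOn e) (f : ℕ → ℕ) :
    ConvergesTo (boundedPart x S e f) x := by
  intro V hV
  obtain ⟨ε, hε, hball⟩ := Metric.mem_nhds_iff.1 hV
  refine Set.Finite.of_finite_image (f := e) ?_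
    (he.mono fun y hy => hy.1.1)
  refine (Set.finite_Iic (∑ i ∈ Finset.range (⌊ε⁻¹⌋₊ + 1), f i)).subset ?_
  rintro _ ⟨y, ⟨⟨-, -, hy⟩, hyV⟩, rfl⟩
  -- Partial sums make the bound monotone in the proximity, so `f` itself need not be monotone.
  refine hy.trans (Finset.sum_le_sum_of_subset (Finset.range_mono ?_))
  have : ε ≤ dist y x := by
    by_contra! h
    exact hyV (hball h)
  gcongr

theorem exists_local_family (x : M) {U : Set M} (hU : U ∈ 𝓝 x) : ∃ 𝒞 : Set (Set M),
    (∀ C ∈ 𝒞, IsConvergentSequence C ∧ x ∈ C ∧ ConvergesTo C x) ∧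
    (∀ A : Set M, x ∈ closure A → x ∉ A → ∃ C ∈ 𝒞, (C ∩ A).Infinite) ∧
    #𝒞 ≤ covNumber #U * lift.{u} boundingNumber := by
  obtain ⟨F, hF, hcov, hFcard⟩ := exists_cover_mk_eq_covNumber U
  obtain ⟨B, hB, hBcard⟩ := exists_unbounded_mk_eq_boundingNumber
  have hFc : ∀ S : F, ((Subtype.val : U → M) '' S.1).Countable := fun S =>
    (hF S.1 S.2).image _
  choose e he using fun S : F => Set.countable_iff_exists_injOn.1 (hFc S)
  let P : F × B → Set M := fun p => boundedPart x (Subtype.val '' p.1.1) (e p.1) p.2.1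
  have hP : ∀ p, ConvergesTo (P p) x := fun p => convergesTo_boundedPart x (he p.1) _
  -- Finite pieces are dropped because a convergent sequence must be infinite.
  refine ⟨{C ∈ Set.range fun p => insert x (P p) | C.Infinite}, ?_, ?_, ?_⟩
  · rintro _ ⟨⟨p, rfl⟩, hinf⟩
    have hinf' : (P p).Infinite := fun hfin => hinf (hfin.insert x)
    refine ⟨isConvergentSequence_insert hinf' ((hFc p.1).mono fun y hy => hy.1) (hP p),
      Set.mem_insert _ _, fun V hV => (hP p V hV).subset ?_⟩
    rintro y ⟨rfl | hy, hyV⟩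
    · exact absurd (mem_of_mem_nhds hV) hyV
    · exact ⟨hy, hyV⟩
  · intro A hxA hxnA
    have hex : ∀ N : ℕ, ∃ y : U, y.1 ∈ A ∧ y.1 ≠ x ∧ N ≤ ⌊(dist y.1 x)⁻¹⌋₊ := fun N => by
      obtain ⟨y, ⟨hyU, hyb⟩, hyA⟩ := mem_closure_iff_nhds.1 hxA _
        (inter_mem hU (Metric.ball_mem_nhds x (inv_pos.2 (Nat.cast_add_one_pos (α := ℝ) N))))
      have hyx : y ≠ x := fun h => hxnA (h ▸ hyA)
      refine ⟨⟨y, hyU⟩, hyA, hyx, Nat.le_floor ?_⟩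
      have hpos := dist_pos.2 hyx
      have := (lt_inv_comm₀ hpos (Nat.cast_add_one_pos (α := ℝ) N)).1 hyb
      linarith
    choose y hyA hyx hy using hex
    obtain ⟨S, hS, hyS⟩ := hcov (Set.range y) (Set.countable_range y)
    -- Otherwise the codes of the `y N` would bound all of `B`.
    have hB' : ∃ f ∈ B, ∃ᶠ N in atTop, e ⟨S, hS⟩ (y N) ≤ f N := by
      by_contra! h
      refine hB ⟨fun N => e ⟨S, hS⟩ (y N), fun f hf => ?_⟩
      simpa [Filter.Frequently] using h f hf
    obtain ⟨f, hf, hfreq⟩ := hB'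
    have hmem : ∀ N, e ⟨S, hS⟩ (y N) ≤ f N → (y N : M) ∈ P (⟨S, hS⟩, ⟨f, hf⟩) := fun N hN =>
      ⟨⟨y N, hyS ⟨N, rfl⟩, rfl⟩, hyx N, hN.trans
        (Finset.single_le_sum (fun _ _ => Nat.zero_le _)
          (Finset.mem_range.2 (Nat.lt_succ_of_le (hy N))))⟩
    have hinf : (P (⟨S, hS⟩, ⟨f, hf⟩) ∩ A).Infinite := by
      intro hfin
      -- The captured terms come arbitrarily close to `x`, so they cannot form a finite set.
      obtain ⟨K, hK⟩ := (hfin.image fun z => ⌊(dist z x)⁻¹⌋₊).bddAbove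
      obtain ⟨N, hNK, hN⟩ := Filter.frequently_atTop.1 hfreq (K + 1)
      have := hK ⟨y N, ⟨hmem N hN, hyA N⟩, rfl⟩
      have := hy N
      grind
    have hinf' := hinf.mono (Set.inter_subset_inter_left A (Set.subset_insert x _))
    exact ⟨_, ⟨⟨_, rfl⟩, hinf'.mono Set.inter_subset_left⟩, hinf'⟩
  · calc _ ≤ #(Set.range fun p => insert x (P p)) := mk_le_mk_of_subset (Set.sep_subset _ _)
      _ ≤ #(F × B) := mk_range_le
      _ = _ := by rw [mk_prod, hFcard, hBcard]; simp

theorem exists_generating_family {c : Cardinal.{u}} (hM : #M ≤ c) (hc : ℵ₀ ≤ c)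
    (h : ∀ x : M, ∃ U ∈ 𝓝 x, covNumber #U * lift.{u} boundingNumber ≤ c) :
    ∃ 𝒞 : Set (Set M), (∀ C ∈ 𝒞, IsConvergentSequence C) ∧ GeneratesTopology 𝒞 ∧ #𝒞 ≤ c := by
  choose U hU hUc using h
  choose 𝒞 hseq hinf hcard using fun x : M => exists_local_family x (hU x)
  refine ⟨⋃ x, 𝒞 x, ?_, generatesTopology_of_infinite_inter fun A x hx hxA => ?_, ?_⟩
  · intro C hC
    obtain ⟨x, hx⟩ := Set.mem_iUnion.1 hC
    exact (hseq x C hx).1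
  · obtain ⟨C, hC, hCA⟩ := hinf x A hx hxA
    obtain ⟨-, h2, h3⟩ := hseq x C hC
    exact ⟨C, Set.mem_iUnion.2 ⟨x, hC⟩, h2, h3, hCA⟩
  · calc #(⋃ x, 𝒞 x) ≤ #M * ⨆ x, #(𝒞 x) := mk_iUnion_le _
      _ ≤ c * c := mul_le_mul' hM (ciSup_le' fun x => (hcard x).trans (hUc x))
      _ = c := mul_eq_self hc

end UpperBound

/-! ### Decoding a generating family at a point -/

section LowerBound

variable {M : Type u} [MetricSpace M] {𝒞 : Set (Set M)}

theorem tendsto_of_mem_ball {a : ℕ → M} {x : M} (h : ∀ n : ℕ, a n ∈ Metric.ball x (1 / (n + 1))) :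
    Tendsto a atTop (𝓝 x) :=
  tendsto_iff_dist_tendsto_zero.2 <| squeeze_zero (fun _ => dist_nonneg) (fun n => (h n).le)
    tendsto_one_div_add_atTop_nhds_zero_nat

/-- Finite subsets of `μ` are coded by points in each ball around `x`. The codes of the initial
segments of an enumeration of `T` tend to `x`, and infinitely many of them recover `T`. -/
theorem GeneratesTopology.covNumber_le (hgen : GeneratesTopology 𝒞)
    (hseq : ∀ C ∈ 𝒞, IsConvergentSequence C) {x : M} {μ : Cardinal.{u}}
    (hx : ∀ U ∈ 𝓝 x, μ ≤ #U ∧ ℵ₀ < #U) : covNumber μ ≤ #𝒞 := by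
  have hemb : ∀ n : ℕ, ∃ j : Finset μ.out → M, Function.Injective j ∧
      ∀ s, j s ∈ Metric.ball x (1 / (n + 1)) \ {x} := fun n => by
    obtain ⟨h1, h2⟩ := hx _ (Metric.ball_mem_nhds x (Nat.one_div_pos_of_nat (α := ℝ) (n := n)))
    set U := Metric.ball x (1 / ((n : ℝ) + 1))
    have hle : #(Finset μ.out) ≤ #(U \ {x} : Set M) := by
      have hdiff : #U ≤ #(U \ {x} : Set M) + 1 := by
        have := le_mk_sdiff_add_mk U {x}
        rwa [mk_singleton] at this
      have hinf : ℵ₀ ≤ #(U \ {x} : Set M) := by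
        by_contra! h
        exact absurd (hdiff.trans_lt (add_lt_aleph0 h one_lt_aleph0)) (not_lt.2 h2.le)
      rw [add_one_eq hinf] at hdiff
      rcases finite_or_infinite μ.out with hfin | hfin
      · exact (lt_aleph0_of_finite _).le.trans hinf
      · rw [mk_finset_of_infinite, mk_out]
        exact h1.trans hdiff
    obtain ⟨j⟩ := hle
    exact ⟨fun s => j s, Subtype.val_injective.comp j.injective, fun s => (j s).2⟩
  choose j hj hjmem using hemb
  let S : 𝒞 → Set μ.out := fun C => ⋃ n, ⋃ s ∈ j n ⁻¹' C.1, (s : Set μ.out)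
  refine le_trans (csInf_le' ⟨Set.range S, ?_, fun T hT => ?_, rfl⟩) mk_range_le
  · rintro _ ⟨C, rfl⟩
    exact Set.countable_iUnion fun n => Set.Countable.biUnion
      ((hseq C.1 C.2).countable.preimage (hj n)) fun s _ => s.countable_toSet
  · rcases T.eq_empty_or_nonempty with rfl | hne
    · obtain ⟨C, hC, -⟩ := hgen.exists_infinite_inter hseq
        (tendsto_of_mem_ball fun n => (hjmem n ∅).1) fun n => (hjmem n ∅).2
      exact ⟨_, ⟨⟨C, hC⟩, rfl⟩, Set.empty_subset _⟩
    · obtain ⟨t, rfl⟩ := hT.exists_eq_range hne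
      classical
      let s : ℕ → Finset μ.out := fun n => (Finset.range n).image t
      obtain ⟨C, hC, -, hinf⟩ := hgen.exists_infinite_inter hseq
        (tendsto_of_mem_ball fun n => (hjmem n (s n)).1) fun n => (hjmem n (s n)).2
      refine ⟨_, ⟨⟨C, hC⟩, rfl⟩, ?_⟩
      rintro _ ⟨i, rfl⟩
      -- The `n`-th segment lists `t` only below `n`, hence the strict `i < n`.
      obtain ⟨n, hn, hin⟩ := hinf.exists_gt i
      simp only [S, Set.mem_iUnion]
      exact ⟨n, s n, hn, by
        simpa [s] using ⟨i, hin, rfl⟩⟩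

/-- Each ball contains an infinite set `j n` bounded away from `x`, which a `C` converging to `x`
meets finitely often. The largest index met defines a function of `n`, and these functions are
unbounded: a bound `g` would give a sequence `j n (g n)` that some `C` catches. -/
theorem GeneratesTopology.boundingNumber_le (hgen : GeneratesTopology 𝒞)
    (hseq : ∀ C ∈ 𝒞, IsConvergentSequence C) {x : M}
    (hx : ∀ U ∈ 𝓝 x, ℵ₀ < #U) : lift.{u} boundingNumber ≤ #𝒞 := by
  have hemb : ∀ n : ℕ, ∃ (j : ℕ → M) (V : Set M), Function.Injective j ∧ V ∈ 𝓝 x ∧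
      (∀ k, j k ∉ V) ∧ ∀ k, j k ∈ Metric.ball x (1 / (n + 1)) := fun n => by
    have h1 := hx _ (Metric.ball_mem_nhds x (Nat.one_div_pos_of_nat (α := ℝ) (n := n)))
    set U := Metric.ball x (1 / ((n : ℝ) + 1))
    -- If every such shell were finite, the ball would be countable.
    have hex : ∃ m : ℕ, (U \ Metric.ball x (1 / (m + 1))).Infinite := by
      by_contra! h
      refine absurd h1 (not_lt.2 (Set.Countable.le_aleph0 ?_))
      refine (((Set.countable_iUnion fun m => (h m).countable).insert x)).mono fun y hy => ?_
      rcases eq_or_ne y x with rfl | hyx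
      · exact Set.mem_insert _ _
      · obtain ⟨m, hm⟩ := exists_nat_one_div_lt (dist_pos.2 hyx)
        exact Or.inr (Set.mem_iUnion.2 ⟨m, hy, fun h => lt_asymm hm h⟩)
    obtain ⟨m, hm⟩ := hex
    have j := hm.natEmbedding
    exact ⟨fun k => j k, _, Subtype.val_injective.comp j.injective,
      Metric.ball_mem_nhds x Nat.one_div_pos_of_nat, fun k => (j k).2.2, fun k => (j k).2.1⟩
  choose j V hj hV hjV hjmem using hemb
  -- On an unbounded set `sSup` is the default `0`; only `C` converging to `x` matter, where the set
  -- is finite.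
  let f : 𝒞 → ℕ → ℕ := fun C n => sSup {k | j n k ∈ C.1}
  have hle : boundingNumber ≤ #(Set.range f) := by
    refine csInf_le' ⟨_, ?_, rfl⟩
    rintro ⟨g, hg⟩
    obtain ⟨C, hC, hconv, hinf⟩ := hgen.exists_infinite_inter hseq
      (a := fun n => j n (g n)) (tendsto_of_mem_ball fun n => hjmem n (g n))
      fun n h => hjV n (g n) (h ▸ mem_of_mem_nhds (hV n))
    have hev := hg _ ⟨⟨C, hC⟩, rfl⟩
    obtain ⟨N, hN⟩ := eventually_atTop.1 hev
    obtain ⟨n, hn, hNn⟩ := hinf.exists_gt N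
    refine absurd (hN n hNn.le) (not_lt.2 (le_csSup (Set.Finite.bddAbove ?_) hn))
    exact ((hconv _ (hV n)).preimage (hj n).injOn).subset fun k hk => ⟨hk, hjV n k⟩
  calc lift.{u} boundingNumber ≤ lift.{u} #(Set.range f) := lift_le.2 hle
    _ ≤ #𝒞 := by simpa using mk_range_le_lift (f := f)

theorem GeneratesTopology.covNumber_mul_boundingNumber_le (hgen : GeneratesTopology 𝒞)
    (hseq : ∀ C ∈ 𝒞, IsConvergentSequence C) {x : M} {μ : Cardinal.{u}}
    (hx : ∀ U ∈ 𝓝 x, μ ≤ #U ∧ ℵ₀ < #U) : covNumber μ * lift.{u} boundingNumber ≤ #𝒞 := by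
  have hb := hgen.boundingNumber_le hseq fun U hU => (hx U hU).2
  refine (mul_le_mul' (hgen.covNumber_le hseq hx) hb).trans_eq (mul_eq_self ?_)
  exact aleph0_le_lift_boundingNumber.trans hb

end LowerBound

/-! ### Assembling the two bounds -/

section SequentialityNumber

theorem mk_le_mul_of_locally_le {M : Type u} [TopologicalSpace M] [SecondCountableTopology M]
    {c : Cardinal.{u}} (h : ∀ x : M, ∃ U ∈ 𝓝 x, #U ≤ c) : #M ≤ ℵ₀ * c := by
  choose U hU hUc using h
  obtain ⟨s, hs, hcov⟩ := TopologicalSpace.countable_cover_nhds hU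
  calc #M = #(⋃ x ∈ s, U x) := by rw [hcov, mk_univ]
    _ ≤ #s * ⨆ x : s, #(U x) := mk_biUnion_le _ _
    _ ≤ ℵ₀ * c := mul_le_mul' hs.le_aleph0 (ciSup_le' fun x => hUc x)

theorem seqNumber_eq {M : Type u} [MetricSpace M] {c : Cardinal.{u}}
    (hM : #M ≤ c) (hc : ℵ₀ ≤ c)
    (hupper : ∀ x : M, ∃ U ∈ 𝓝 x, covNumber #U * lift.{u} boundingNumber ≤ c)
    (hlower : ∀ 𝒞 : Set (Set M), (∀ C ∈ 𝒞, IsConvergentSequence C) → GeneratesTopology 𝒞 →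
      c ≤ #𝒞) : seqNumber M = c := by
  obtain ⟨𝒞, hseq, hgen, hcard⟩ := exists_generating_family hM hc hupper
  refine le_antisymm (le_trans (csInf_le' ⟨𝒞, hseq, hgen, rfl⟩) hcard) ?_
  refine le_csInf ⟨_, 𝒞, hseq, hgen, rfl⟩ ?_
  rintro _ ⟨𝒟, h1, h2, rfl⟩
  exact hlower 𝒟 h1 h2

theorem aleph0_le_covNumber_mul (κ : Cardinal.{u}) :
    ℵ₀ ≤ covNumber κ * lift.{u} boundingNumber :=
  aleph0_le_lift_boundingNumber.trans
    (le_mul_of_one_le_left' (one_le_covNumber κ))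

end SequentialityNumber

theorem mainTheorem1 (M : Type u) [TopologicalSpace M] [TopologicalSpace.SeparableSpace M]
    [TopologicalSpace.MetrizableSpace M] [Uncountable M] :
    (¬ IsLocallySmall M → seqNumber M = covNumber #M * lift.{u} boundingNumber) ∧
    (IsLocallySmall M → seqNumber M = covBoundingLimit #M) := by
  let _ := TopologicalSpace.metrizableSpaceMetric M
  have : SecondCountableTopology M := UniformSpace.secondCountable_of_separable M
  have hunc : ℵ₀ < #M := aleph0_lt_mk
  refine ⟨fun hls => ?_, fun hls => ?_⟩
  · refine seqNumber_eq (le_covNumber_mul_of_aleph0_le _ aleph0_le_lift_boundingNumber)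
      (aleph0_le_covNumber_mul _) (fun x => ⟨Set.univ, univ_mem, by rw [mk_univ]⟩)
      fun 𝒞 hseq hgen => ?_
    unfold IsLocallySmall at hls
    push Not at hls
    obtain ⟨x, hx⟩ := hls
    exact hgen.covNumber_mul_boundingNumber_le hseq fun U hU =>
      ⟨hx U hU, hunc.trans_le (hx U hU)⟩
  · have hle : ∀ μ < #M, covNumber μ * lift.{u} boundingNumber ≤ covBoundingLimit #M :=
      fun μ hμ => le_ciSup (bddAbove_covBoundingLimit #M) ⟨μ, hμ⟩
    have hinf : ℵ₀ ≤ covBoundingLimit #M :=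
      (aleph0_le_covNumber_mul 0).trans (hle 0 (aleph0_pos.trans hunc))
    have hMle : #M ≤ ℵ₀ * covBoundingLimit #M := mk_le_mul_of_locally_le fun x => by
      obtain ⟨U, hU, hlt⟩ := hls x
      exact ⟨U, hU, (le_covNumber_mul_of_aleph0_le _ aleph0_le_lift_boundingNumber).trans
        (hle _ hlt)⟩
    rw [aleph0_mul_eq hinf] at hMle
    refine seqNumber_eq hMle hinf (fun x => ?_) fun 𝒞 hseq hgen => ?_
    · obtain ⟨U, hU, hlt⟩ := hls x
      exact ⟨U, hU, hle _ hlt⟩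
    · refine ciSup_le' fun μ => ?_
      -- Otherwise countably many neighborhoods of size at most `max μ ℵ₀ < |M|` would cover `M`.
      have hx : ∃ x : M, ∀ U ∈ 𝓝 x, max μ.1 ℵ₀ < #U := by
        by_contra! h
        have := mk_le_mul_of_locally_le h
        rw [aleph0_mul_eq (le_max_right _ _)] at this
        exact absurd (max_lt μ.2 hunc) (not_lt.2 this)
      obtain ⟨x, hx⟩ := hx
      exact hgen.covNumber_mul_boundingNumber_le hseq fun U hU =>
        ⟨(le_max_left _ _).trans (hx U hU).le, (le_max_right _ _).trans_lt (hx U hU)⟩
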